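/- Let $N,T\ge 1$ and let $P$ be a nondegenerate elliptical distribution on $\mathbb R^N$, i.e. the law of $m+Az$, where $m\in\mathbb R^N$ is an arbitrary location vector, $A$ is an invertible $N\times N$ matrix, and $z$ is a random vector whose law is invariant under all orthogonal transformations, with $z\neq 0$ almost surely. Let $x_1,\dots,x_T$ be independent random vectors with law $P$ (the returns of $N$ assets in $T$ periods), and let $\mathbf X=(x_{it})$ be the random $N\times T$ matrix whose $t$-th column is $x_t$. For a matrix $X$ and $a\in\mathbb R$ let $X+a$ be the matrix obtained by adding $a$ to each entry of $X$. A portfolio $w\in\mathbb R^N$ is normalized if $\sum_i w_i=1$. A risk measure estimator assigns a real number $\hat\rho(w|X)$ to each portfolio $w\in\mathbb R^N$ and each real $N\times T$ matrix $X$. It is coherent on the sample $X$ if for every sample $Y$ of the form $X+a$, $a\in\mathbb R$ (including $X$ itself), and all portfolios $u,v$: 1. (monotonicity) if $\sum_i u_i y_{it}\ge 0$ for all $t$, then $\hat\rho(u|Y)\le 0$; 2. (sub-additivity) $\hat\rho(u+v|Y)\le\hat\rho(u|Y)+\hat\rho(v|Y)$; 3. (positive homogeneity) $\hat\rho(bu|Y)=b\,\hat\rho(u|Y)$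 for all $b>0$; and moreover 4. (translational invariance) $\hat\rho(u|X+a)=\hat\rho(u|X)-a$ for all $a\in\mathbb R$ and all normalized $u$. The portfolio optimization problem under $\hat\rho$ on $X$ is to minimize $\hat\rho(w|X)$ over all normalized portfolios $w$; it is infeasible if no minimizer exists. Put $$p(N,T)=\Theta(T-N)\,\frac{1}{2^{T-1}}\sum_{k=N-1}^{T-1}\binom{T-1}{k},\qquad \Theta(x)=1\text{ for }x\ge 0,\quad \Theta(x)=0\text{ for }x<0.$$ Then the portfolio optimization problem under any coherent measure on the sample $\mathbf X$ is infeasible with probability at least $1-p(N,T)$. More precisely, there is a measurable event $E$ of probability at least $1-p(N,T)$ such that, for every outcome in $E$ and every risk measure estimator $\hat\rho$ that is coherent on the realized sample $\mathbf X$, the portfolio optimization problem under $\hat\rho$ on $\mathbf X$ is infeasible. -/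

import Mathlib

open MeasureTheory ProbabilityTheory

/-- The law on `ℝ^N` is spherically symmetric: it is invariant under every linear isometry. -/
def IsSpherical {N : ℕ} (ν : Measure (EuclideanSpace ℝ (Fin N))) : Prop :=
  ∀ U : EuclideanSpace ℝ (Fin N) ≃ₗᵢ[ℝ] EuclideanSpace ℝ (Fin N), ν.map U = ν

/-- `P` is a (nondegenerate) elliptical distribution on `ℝ^N`: it is the law of `m + A z`, where
`m` is an arbitrary location vector, `A` is an invertible linear map (so the dispersion matrix
`A Aᵀ` is positive definite) and `z` is a spherically symmetric random vector
with `z ≠ 0` almost surely. -/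
def IsElliptical {N : ℕ} (P : Measure (EuclideanSpace ℝ (Fin N))) : Prop :=
  ∃ (m : EuclideanSpace ℝ (Fin N))
    (A : EuclideanSpace ℝ (Fin N) ≃L[ℝ] EuclideanSpace ℝ (Fin N))
    (ν : Measure (EuclideanSpace ℝ (Fin N))),
    IsProbabilityMeasure ν ∧ IsSpherical ν ∧ ν {0} = 0 ∧ P = ν.map (fun z => m + A z)

/-- The return `∑ i, w i * x i t` of the portfolio `w` in period `t` on the sample `X`. -/
def portfolioReturn {N T : ℕ} (w : Fin N → ℝ) (X : Matrix (Fin N) (Fin T) ℝ) (t : Fin T) : ℝ :=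
  ∑ i, w i * X i t

/-- A portfolio is normalized if its weights sum to one. -/
def IsNormalized {N : ℕ} (w : Fin N → ℝ) : Prop := ∑ i, w i = 1

/-- The sample `X + a`: the number `a` is added to each element of `X`. -/
def shiftSample {N T : ℕ} (X : Matrix (Fin N) (Fin T) ℝ) (a : ℝ) : Matrix (Fin N) (Fin T) ℝ :=
  Matrix.of fun i t => X i t + a

/-- The risk measure estimator `ρ` is coherent on the sample `X`. As translational invariance
compares `X` with the shifted samples `X + a`, the other three axioms are required on all of these
(`a = 0` gives `X` itself). Translational invariance concerns normalized portfolios, whose return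
increases by exactly `a` when `X` is replaced with `X + a`. -/
structure IsCoherentOn {N T : ℕ} (ρ : (Fin N → ℝ) → Matrix (Fin N) (Fin T) ℝ → ℝ)
    (X : Matrix (Fin N) (Fin T) ℝ) : Prop where
  monotonicity : ∀ (a : ℝ) (u : Fin N → ℝ),
    (∀ t, 0 ≤ portfolioReturn u (shiftSample X a) t) → ρ u (shiftSample X a) ≤ 0
  subadditivity : ∀ (a : ℝ) (u v : Fin N → ℝ),
    ρ (u + v) (shiftSample X a) ≤ ρ u (shiftSample X a) + ρ v (shiftSample X a)
  positive_homogeneity : ∀ (a : ℝ) (b : ℝ) (u : Fin N → ℝ), 0 < b →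
    ρ (b • u) (shiftSample X a) = b * ρ u (shiftSample X a)
  translational_invariance : ∀ (a : ℝ) (u : Fin N → ℝ), IsNormalized u →
    ρ u (shiftSample X a) = ρ u X - a

/-- The problem of minimizing `ρ w X` over all normalized portfolios `w` has a solution. -/
def IsFeasible {N T : ℕ} (ρ : (Fin N → ℝ) → Matrix (Fin N) (Fin T) ℝ → ℝ)
    (X : Matrix (Fin N) (Fin T) ℝ) : Prop :=
  ∃ w : Fin N → ℝ, IsNormalized w ∧ ∀ v : Fin N → ℝ, IsNormalized v → ρ w X ≤ ρ v X

/-- The sample whose column `t` is the vector of returns observed in period `t`. -/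
def sampleMatrix {N T : ℕ} (x : Fin T → EuclideanSpace ℝ (Fin N)) : Matrix (Fin N) (Fin T) ℝ :=
  Matrix.of fun i t => x t i

/-- `p(N,T) = Θ(T-N) 2^{-(T-1)} ∑_{k=N-1}^{T-1} C(T-1,k)`, for `N, T ≥ 1`, with `Θ(0) = 1`. -/
noncomputable def minimaxProb (N T : ℕ) : ℝ :=
  (if N ≤ T then 1 else 0) *
    ((1 / 2 ^ (T - 1)) * ∑ k ∈ Finset.Icc (N - 1) (T - 1), ((T - 1).choose k : ℝ))

/-! If some zero-sum portfolio has a positive return in every period, adding enough of it to any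
normalized `w` pushes all returns above any level. Monotonicity and translational invariance then
give a risk below that of `w`, so there is no minimizer (`not_isFeasible_of_forall_pos`). Such a
portfolio exists exactly when the projections of the columns onto the zero-sum hyperplane, of
dimension `N - 1`, do not have the origin in their convex hull. After subtraction of the location
vector `m`, the projected points are independent with a common symmetric law that charges no
hyperplane (for `N ≥ 2`), and the question is how often their hull misses the fixed point `p`, minus
the projection of `m`.

By symmetry all sign changes of the points are equally likely, so it suffices to count signs for
fixed points in general position. For `p = 0` this is Wendel's theorem, of which only the lower
bound is needed (`wendelCount_le_card`). For `p ≠ 0` the key is `card_mem_convexHull_le`: over the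
sign changes, the hull contains `p` at most as often as the origin. Its proof follows the ray from
the origin through `p`. If the hull is entered between the origin and `p`, flipping the signs of all
points off the entry facet turns that facet into the exit facet of a new hull, which the ray leaves
before `p`. The flip is injective, and comparing cardinalities gives the claim. -/

/-! ### General position and supporting hyperplanes -/

/-- The points `0`, `p` and `y t` as a single family. -/
def originAndPoints {ι E : Type*} [Zero E] (p : E) (y : ι → E) : Option (Option ι) → E
  | none => 0
  | some none => p
  | some (some t) => y t

/-- Any `dim E + 1` of the points `0`, `p` and `y t` are affinely independent. -/
def InGeneralPosition {ι E : Type*} [AddCommGroup E] [Module ℝ E] (p : E) (y : ι → E) : Prop :=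
  ∀ J : Finset (Option (Option ι)), J.card ≤ Module.finrank ℝ E + 1 →
    AffineIndependent ℝ (fun j : J => originAndPoints p y j)

theorem mem_convexHull_range_iff {ι E : Type*} [Fintype ι] [AddCommGroup E] [Module ℝ E]
    {y : ι → E} {x : E} :
    x ∈ convexHull ℝ (Set.range y) ↔
      ∃ l : ι → ℝ, (∀ t, 0 ≤ l t) ∧ ∑ t, l t = 1 ∧ ∑ t, l t • y t = x := by
  classical
  constructor
  · intro hx
    rw [convexHull_range_eq_exists_affineCombination] at hx
    obtain ⟨s, w, hw0, hw1, rfl⟩ := hx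
    refine ⟨fun t => if t ∈ s then w t else 0, fun t => ?_, ?_, ?_⟩
    · dsimp only
      split_ifs with h
      · exact hw0 t h
      · exact le_rfl
    · simpa using hw1
    · rw [s.affineCombination_eq_linear_combination _ _ hw1]
      simp [ite_smul]
  · rintro ⟨l, h0, h1, rfl⟩
    exact mem_convexHull_of_exists_fintype l y h0 h1 (fun t => ⟨t, rfl⟩) rfl

namespace InGeneralPosition

section
variable {ι E : Type*} [AddCommGroup E] [Module ℝ E] {p : E} {y : ι → E}

/-- With fewer points in the support, these together with `0` and `p` would be affinely independent.
But `∑ l t • y t - s • p - (1 - s) • 0 = 0` is a relation of total weight zero. -/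
theorem finrank_le_card_support [Fintype ι] (h : InGeneralPosition p y)
    {l : ι → ℝ} (hl : ∑ t, l t = 1) {s : ℝ} (hs : ∑ t, l t • y t = s • p) :
    Module.finrank ℝ E ≤ (Finset.univ.filter fun t => l t ≠ 0).card := by
  classical
  by_contra! hlt
  set I := Finset.univ.filter fun t => l t ≠ 0 with hI
  have hJ := h (Finset.insertNone (Finset.insertNone I)) (by simp; omega)
  let w : Option (Option ι) → ℝ
    | none => -(1 - s)
    | some none => -s
    | some (some t) => l t
  have hl' : ∑ t ∈ I, l t = 1 := by rw [hI, Finset.sum_filter_ne_zero, hl]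
  have hs' : ∑ t ∈ I, l t • y t = s • p := by
    rw [← hs, hI]
    refine Finset.sum_subset (Finset.subset_univ _) fun t _ ht => ?_
    have : l t = 0 := by simpa using ht
    simp [this]
  have hz := affineIndependent_iff.1 hJ Finset.univ (fun j => w j)
    (by rw [Finset.sum_coe_sort _ w]
        simp only [Finset.sum_insertNone, w, hl']; ring)
    (by rw [Finset.sum_coe_sort _ (fun j => w j • originAndPoints p y j)]
        simp only [Finset.sum_insertNone, w, originAndPoints, hs']; simp)
  have : ∑ t ∈ I, l t = 0 := Finset.sum_eq_zero fun t ht =>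
    hz ⟨some (some t), by simpa using ht⟩ (Finset.mem_univ _)
  linarith

variable [FiniteDimensional ℝ E]

/-- Affinely independent points of this number span the whole space affinely, so no hyperplane
contains them. The next three lemmas apply this with `0` or `p` included in `J` or not. -/
theorem eq_zero_of_forall_eq (h : InGeneralPosition p y) {J : Finset (Option (Option ι))}
    (hJ : J.card = Module.finrank ℝ E + 1) {a : E →ₗ[ℝ] ℝ} {c : ℝ}
    (ha : ∀ j ∈ J, a (originAndPoints p y j) = c) : a = 0 ∧ c = 0 := by
  have htop := (h J hJ.le).affineSpan_eq_top_iff_card_eq_finrank_add_one.2 (by simpa using hJ)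
  have key : ∀ x, a x = c := by
    intro x
    have hx : x ∈ affineSpan ℝ (Set.range fun j : J => originAndPoints p y j) := by
      rw [htop]; trivial
    refine affineSpan_induction (p := fun x => a x = c) hx ?_ fun r u v w hu hv hw => ?_
    · rintro _ ⟨j, rfl⟩
      exact ha j j.2
    · simp [hu, hv, hw]
  have hc : c = 0 := by simpa using (key 0).symm
  exact ⟨LinearMap.ext fun x => by simp [key, hc], hc⟩

theorem card_le_finrank (h : InGeneralPosition p y) {a : E →ₗ[ℝ] ℝ} {c : ℝ} (hc : c ≠ 0)
    {S : Finset ι} (hS : ∀ t ∈ S, a (y t) = c) : S.card ≤ Module.finrank ℝ E := by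
  by_contra! hlt
  obtain ⟨S', hS', hcard⟩ := Finset.exists_subset_card_eq (Nat.succ_le_of_lt hlt)
  refine hc (h.eq_zero_of_forall_eq (J := (S'.map .some).map .some) (by simpa using hcard)
    (a := a) (c := c) ?_).2
  simp only [Finset.mem_map, Function.Embedding.some_apply]
  rintro j ⟨_, ⟨t, ht, rfl⟩, rfl⟩
  exact hS t (hS' ht)

theorem card_lt_finrank (h : InGeneralPosition p y) {a : E →ₗ[ℝ] ℝ} {c : ℝ} (hc : c ≠ 0)
    (hp : a p = c) {S : Finset ι} (hS : ∀ t ∈ S, a (y t) = c) :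
    S.card < Module.finrank ℝ E := by
  by_contra! hlt
  obtain ⟨S', hS', hcard⟩ := Finset.exists_subset_card_eq hlt
  refine hc (h.eq_zero_of_forall_eq (J := (Finset.insertNone S').map .some)
    (by simpa using hcard) (a := a) (c := c) ?_).2
  intro j hj
  simp only [Finset.mem_map, Function.Embedding.some_apply] at hj
  obtain ⟨j, hj, rfl⟩ := hj
  cases j with
  | none => exact hp
  | some t => exact hS t (hS' (by simpa using hj))

theorem eq_zero_of_finrank_le (h : InGeneralPosition p y) {a : E →ₗ[ℝ] ℝ} {S : Finset ι}
    (hcard : Module.finrank ℝ E ≤ S.card) (hS : ∀ t ∈ S, a (y t) = 0) : a = 0 := by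
  obtain ⟨S', hS', hcard⟩ := Finset.exists_subset_card_eq hcard
  refine (h.eq_zero_of_forall_eq (J := Finset.insertNone (S'.map .some))
    (by simpa using hcard) (a := a) (c := 0) ?_).1
  intro j hj
  cases j with
  | none => simp [originAndPoints]
  | some j =>
    simp only [Finset.some_mem_insertNone, Finset.mem_map, Function.Embedding.some_apply] at hj
    obtain ⟨t, ht, rfl⟩ := hj
    exact hS t (hS' ht)

end

variable {ι E : Type*} [Fintype ι] [NormedAddCommGroup E] [NormedSpace ℝ E]
  [FiniteDimensional ℝ E] {p : E} {y : ι → E}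

/-- Separating the points of the segment just before `α • p` from the hull and passing to a limit
gives a supporting functional that is nonnegative at `p`. If it vanished at `p`, it would vanish at
the at least `finrank` points that carry `α • p`, which general position forbids. -/
theorem exists_supporting (h : InGeneralPosition p y) {α : ℝ} (hα : 0 < α)
    (hmem : α • p ∈ convexHull ℝ (Set.range y))
    (hmin : ∀ s, 0 ≤ s → s < α → s • p ∉ convexHull ℝ (Set.range y)) :
    ∃ a : E →ₗ[ℝ] ℝ, a (α • p) = 1 ∧ ∀ t, 1 ≤ a (y t) := by
  classical
  set K := convexHull ℝ (Set.range y) with hK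
  have hKc : IsClosed K := ((Set.finite_range y).isCompact_convexHull ℝ).isClosed
  -- Any sequence in `[0, α)` that tends to `α` serves here; norm one below keeps the limit
  -- functional from being zero.
  let s : ℕ → ℝ := fun n => α * (n / (n + 1))
  have hs0 : ∀ n, 0 ≤ s n := fun n => by positivity
  have hs1 : ∀ n, s n < α := fun n => by
    have : (n : ℝ) / (n + 1) < 1 := by rw [div_lt_one (by positivity)]; linarith
    simpa [s] using mul_lt_mul_of_pos_left this hα
  have hsl : Filter.Tendsto s Filter.atTop (nhds α) := by
    simpa [s] using (tendsto_natCast_div_add_atTop (1 : ℝ) (𝕜 := ℝ)).const_mul α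
  have hsep : ∀ n, ∃ f : StrongDual ℝ E, ‖f‖ = 1 ∧ ∀ b ∈ K, f (s n • p) < f b := by
    intro n
    obtain ⟨f, u, hf1, hf2⟩ := geometric_hahn_banach_point_closed (convex_convexHull ℝ _) hKc
      (hmin (s n) (hs0 n) (hs1 n))
    have hf : f ≠ 0 := by
      rintro rfl
      have := hf2 _ hmem
      simp at hf1 this
      linarith
    refine ⟨‖f‖⁻¹ • f, ?_, fun b hb => ?_⟩
    · rw [norm_smul, norm_inv, norm_norm, inv_mul_cancel₀ (norm_ne_zero_iff.2 hf)]
    · have := mul_lt_mul_of_pos_left (hf1.trans (hf2 b hb)) (inv_pos.2 (norm_pos_iff.2 hf))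
      simpa [mul_left_comm] using this
  choose f hf1 hf2 using hsep
  have hcpt : IsCompact (Metric.sphere (0 : StrongDual ℝ E) 1) := isCompact_sphere _ _
  obtain ⟨b, hb, φ, hφ, hlim⟩ := hcpt.tendsto_subseq (x := f) (fun n => by simp [hf1])
  have hev : ∀ x, Filter.Tendsto (fun n => f (φ n) x) Filter.atTop (nhds (b x)) := fun x =>
    ((ContinuousLinearMap.apply ℝ ℝ x).continuous.tendsto b).comp hlim
  have hle : ∀ x ∈ K, b (α • p) ≤ b x := by
    intro x hx
    have h1 : Filter.Tendsto (fun n => s (φ n) * f (φ n) p) Filter.atTop (nhds (α * b p)) :=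
      (hsl.comp hφ.tendsto_atTop).mul (hev p)
    have := le_of_tendsto_of_tendsto' h1 (hev x) fun n => by
      simpa using (hf2 (φ n) x hx).le
    simpa using this
  have hbp : 0 ≤ b p := ge_of_tendsto' (hev p) fun n => by
    have := hf2 (φ n) _ hmem
    simp only [map_smul, smul_eq_mul] at this
    by_contra! hneg
    nlinarith [hs1 (φ n)]
  obtain ⟨l, hl0, hl1, hl⟩ := mem_convexHull_range_iff.1 hmem
  have heq : ∀ t, l t ≠ 0 → b (y t) = b (α • p) := by
    have hsum : ∑ t, l t * (b (y t) - b (α • p)) = 0 := by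
      simp only [mul_sub, Finset.sum_sub_distrib, ← Finset.sum_mul, hl1, one_mul]
      rw [← hl]
      simp
    intro t ht
    have := (Finset.sum_eq_zero_iff_of_nonneg fun t _ => mul_nonneg (hl0 t)
      (sub_nonneg.2 (hle _ (subset_convexHull ℝ _ ⟨t, rfl⟩)))).1 hsum t (Finset.mem_univ _)
    rcases mul_eq_zero.1 this with h0 | h0
    · exact absurd h0 ht
    · linarith
  have hpos : 0 < b p := by
    refine hbp.lt_of_ne fun h0 => ?_
    have hz : (b : E →ₗ[ℝ] ℝ) = 0 := h.eq_zero_of_finrank_le (h.finrank_le_card_support hl1 hl)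
      fun t ht => by
        have := heq t (by simpa using ht)
        simpa [← h0] using this
    have : b = 0 := by
      ext x
      exact LinearMap.congr_fun hz x
    simp [this] at hb
  have hc : 0 < α * b p := mul_pos hα hpos
  refine ⟨(α * b p)⁻¹ • (b : E →ₗ[ℝ] ℝ), ?_, fun t => ?_⟩
  · simp only [LinearMap.smul_apply, ContinuousLinearMap.coe_coe, map_smul, smul_eq_mul]
    rw [mul_left_comm, inv_mul_cancel₀ hc.ne']
  · have := hle _ (subset_convexHull ℝ _ ⟨t, rfl⟩)
    simp only [map_smul, smul_eq_mul] at this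
    simp only [LinearMap.smul_apply, ContinuousLinearMap.coe_coe, smul_eq_mul]
    rw [← inv_mul_cancel₀ hc.ne']
    exact mul_le_mul_of_nonneg_left this (inv_pos.2 hc).le

end InGeneralPosition

/-! ### Comparison of an arbitrary point with the origin -/

section
variable {ι E : Type*} [Fintype ι] [NormedAddCommGroup E] [NormedSpace ℝ E]
  [FiniteDimensional ℝ E] {p : E} {y : ι → E}

/-- The first point of the segment `[0, p]` in a simplicial polytope that does not contain the
origin lies in the relative interior of a facet whose hyperplane separates the polytope
from the origin. -/
theorem InGeneralPosition.exists_entry_facet (h : InGeneralPosition p y)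
    (h0 : (0 : E) ∉ convexHull ℝ (Set.range y))
    (h1 : ∃ s ∈ Set.Icc (0 : ℝ) 1, s • p ∈ convexHull ℝ (Set.range y)) :
    ∃ (α : ℝ) (a : E →ₗ[ℝ] ℝ) (l : ι → ℝ), 0 < α ∧ α < 1 ∧ a (α • p) = 1 ∧ (∀ t, 1 ≤ a (y t)) ∧
      (∀ t, 0 ≤ l t) ∧ ∑ t, l t = 1 ∧ ∑ t, l t • y t = α • p ∧ ∀ t, l t ≠ 0 ↔ a (y t) = 1 := by
  classical
  have hKc : IsClosed (convexHull ℝ (Set.range y)) :=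
    ((Set.finite_range y).isCompact_convexHull ℝ).isClosed
  have hcpt : IsCompact (Set.Icc (0 : ℝ) 1 ∩ {s | s • p ∈ convexHull ℝ (Set.range y)}) :=
    isCompact_Icc.inter_right (hKc.preimage (by fun_prop : Continuous fun s : ℝ => s • p))
  obtain ⟨α, ⟨⟨hα0, hα1⟩, hα⟩, hleast⟩ := hcpt.exists_isLeast h1
  have hαpos : 0 < α := hα0.lt_of_ne fun h => h0 (by simpa [← h] using hα)
  obtain ⟨a, ha1, ha⟩ := h.exists_supporting hαpos hα fun s hs hsα hmem =>
    not_le.2 hsα (hleast ⟨⟨hs, hsα.le.trans hα1⟩, hmem⟩)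
  obtain ⟨l, hl0, hl1, hl⟩ := mem_convexHull_range_iff.1 hα
  have hsub : ∀ t, l t ≠ 0 → a (y t) = 1 := by
    have hsum : ∑ t, l t * (a (y t) - 1) = 0 := by
      simp only [mul_sub, Finset.sum_sub_distrib, mul_one, hl1]
      rw [← ha1, ← hl]
      simp
    intro t ht
    have := (Finset.sum_eq_zero_iff_of_nonneg fun t _ => mul_nonneg (hl0 t)
      (sub_nonneg.2 (ha t))).1 hsum t (Finset.mem_univ _)
    rcases mul_eq_zero.1 this with h0 | h0
    · exact absurd h0 ht
    · linarith
  have hcard := h.finrank_le_card_support hl1 hl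
  have hcard' := h.card_le_finrank (a := a) one_ne_zero
    (S := Finset.univ.filter fun t => a (y t) = 1) (by simp)
  have hmono := Finset.monotone_filter_right Finset.univ (fun t _ ht => hsub t ht)
  -- The support of `l` has at least `finrank` points and the hyperplane contains at most that many,
  -- so the two sets coincide.
  have heq := Finset.eq_of_subset_of_card_le hmono (hcard'.trans hcard)
  refine ⟨α, a, l, hαpos, hα1.lt_of_ne ?_, ha1, ha, hl0, hl1, hl, fun t => ?_⟩
  · rintro rfl
    have := h.card_lt_finrank (a := a) one_ne_zero (by simpa using ha1)
      (S := Finset.univ.filter fun t => a (y t) = 1) (by simp)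
    exact this.not_ge (hcard.trans (Finset.card_le_card hmono))
  · simpa using Finset.ext_iff.1 heq t

open Classical in
/-- Among the sign changes of points in general position, the convex hull contains the origin
at least as often as any other point. -/
theorem card_mem_convexHull_le [DecidableEq ι] (h : ∀ ε : ι → ℤˣ, InGeneralPosition p fun t => ε t • y t) :
    (Finset.univ.filter fun ε : ι → ℤˣ =>
        p ∈ convexHull ℝ (Set.range fun t => ε t • y t)).card ≤
      (Finset.univ.filter fun ε : ι → ℤˣ =>
        (0 : E) ∈ convexHull ℝ (Set.range fun t => ε t • y t)).card := by
  set K : (ι → ℤˣ) → Set E := fun ε => convexHull ℝ (Set.range fun t => ε t • y t) with hK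
  change (Finset.univ.filter fun ε => p ∈ K ε).card ≤ (Finset.univ.filter fun ε => 0 ∈ K ε).card
  set B := Finset.univ.filter fun ε => p ∈ K ε
  set Z := Finset.univ.filter fun ε => (0 : E) ∈ K ε with hZ
  set Y := Finset.univ.filter fun ε => ∃ s ∈ Set.Icc (0 : ℝ) 1, s • p ∈ K ε with hY
  -- `X` collects the hulls that the ray meets before `p` but not from `p` on. It is disjoint from
  -- `B` inside `Y`, so `|Y \ Z| ≤ |X|` gives `|B| ≤ |Y| - |X| ≤ |Z|`.
  set X := Y.filter fun ε => ∀ s : ℝ, 1 ≤ s → s • p ∉ K ε with hX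
  have hBX : B.card + X.card ≤ Y.card := by
    rw [← Finset.card_union_of_disjoint]
    · refine Finset.card_le_card (Finset.union_subset (fun ε hε => ?_) (Finset.filter_subset _ _))
      simp only [B, Y, Finset.mem_filter, Finset.mem_univ, true_and] at hε ⊢
      exact ⟨1, by simp, by simpa using hε⟩
    · rw [Finset.disjoint_left]
      intro ε hε hε'
      simp only [B, X, Finset.mem_filter, Finset.mem_univ, true_and] at hε hε'
      exact hε'.2 1 le_rfl (by simpa using hε)
  have hYZ : (Y \ Z).card ≤ X.card := by
    have key : ∀ ε ∈ Y \ Z, ∃ (α : ℝ) (a : E →ₗ[ℝ] ℝ) (l : ι → ℝ), 0 < α ∧ α < 1 ∧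
        a (α • p) = 1 ∧ (∀ t, 1 ≤ a (ε t • y t)) ∧ (∀ t, 0 ≤ l t) ∧ ∑ t, l t = 1 ∧
        ∑ t, l t • (ε t • y t) = α • p ∧ ∀ t, l t ≠ 0 ↔ a (ε t • y t) = 1 := by
      intro ε hε
      simp only [Y, Z, Finset.mem_sdiff, Finset.mem_filter, Finset.mem_univ, true_and] at hε
      exact (h ε).exists_entry_facet hε.2 hε.1
    choose! α a l hα0 hα1 haα ha hl0 hl1 hl hla using key
    -- Points off the entry facet have `a > 1`, hence `a < -1` after the flip: the new hull lies on
    -- the origin's side of the same facet, and `α • p` is now the last point of the ray in it.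
    let φ : (ι → ℤˣ) → ι → ℤˣ := fun ε t => if a ε (ε t • y t) = 1 then ε t else -ε t
    have hφ₁ : ∀ {ε t}, a ε (ε t • y t) = 1 → φ ε t = ε t := fun ht => if_pos ht
    have hφ₂ : ∀ {ε t}, a ε (ε t • y t) ≠ 1 → φ ε t = -ε t := fun ht => if_neg ht
    have hφle : ∀ ε ∈ Y \ Z, ∀ t, a ε (φ ε t • y t) ≤ 1 := by
      intro ε hε t
      by_cases ht : a ε (ε t • y t) = 1
      · rw [hφ₁ ht, ht]
      · have := ha ε hε t
        rw [hφ₂ ht, Units.neg_smul, map_neg]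
        linarith
    have hφeq : ∀ ε ∈ Y \ Z, ∀ t, a ε (φ ε t • y t) = 1 → a ε (ε t • y t) = 1 := by
      intro ε hε t ht
      by_contra hne
      have := ha ε hε t
      rw [hφ₂ hne, Units.neg_smul, map_neg] at ht
      linarith
    have hφmem : ∀ ε ∈ Y \ Z, ∑ t, l ε t • (φ ε t • y t) = α ε • p := by
      intro ε hε
      rw [← hl ε hε]
      refine Finset.sum_congr rfl fun t _ => ?_
      by_cases ht : a ε (ε t • y t) = 1
      · rw [hφ₁ ht]
      · have : l ε t = 0 := by
          by_contra h0
          exact ht ((hla ε hε t).1 h0)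
        simp [this]
    have hφK : ∀ ε ∈ Y \ Z, α ε • p ∈ K (φ ε) := fun ε hε =>
      mem_convexHull_range_iff.2 ⟨l ε, hl0 ε hε, hl1 ε hε, hφmem ε hε⟩
    have hmax : ∀ ε ∈ Y \ Z, ∀ s : ℝ, s • p ∈ K (φ ε) → s ≤ α ε := by
      intro ε hε s hs
      have hle : a ε (s • p) ≤ 1 := by
        refine convexHull_min (t := {x | a ε x ≤ 1}) ?_ ?_ hs
        · rintro _ ⟨t, rfl⟩
          exact hφle ε hε t
        · exact convex_halfSpace_le (a ε).isLinear 1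
      have h1 := haα ε hε
      have h0 := hα0 ε hε
      simp only [map_smul, smul_eq_mul] at hle h1
      have hap : 0 < a ε p := by
        by_contra! hneg
        nlinarith
      exact le_of_mul_le_mul_right (hle.trans h1.ge) hap
    refine Finset.card_le_card_of_injOn φ (fun ε hε => ?_) ?_
    · simp only [X, Y, Finset.mem_coe, Finset.mem_filter, Finset.mem_univ, true_and]
      refine ⟨⟨α ε, ⟨(hα0 ε hε).le, (hα1 ε hε).le⟩, hφK ε hε⟩, fun s hs hmem => ?_⟩
      linarith [hmax ε hε s hmem, hα1 ε hε]
    -- Injectivity: the flipped hull determines its exit point, and so `α`. Every point with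
    -- positive weight in the exit point lies on each hyperplane supporting the hull there, so the
    -- facet is determined, and with it the set of signs to flip back.
    · have hfacet : ∀ ε₁ ∈ Y \ Z, ∀ ε₂ ∈ Y \ Z, φ ε₁ = φ ε₂ → ∀ t,
          a ε₁ (ε₁ t • y t) = 1 → a ε₂ (ε₂ t • y t) = 1 := by
        intro ε₁ h₁ ε₂ h₂ heq t ht
        have hαeq : α ε₁ = α ε₂ :=
          le_antisymm (hmax ε₂ h₂ _ (heq ▸ hφK ε₁ h₁)) (hmax ε₁ h₁ _ (heq ▸ hφK ε₂ h₂))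
        have hsum : ∑ t, l ε₁ t * (1 - a ε₂ (φ ε₂ t • y t)) = 0 := by
          simp only [mul_sub, Finset.sum_sub_distrib, mul_one, hl1 ε₁ h₁]
          have := congrArg (a ε₂) (hφmem ε₁ h₁)
          rw [hαeq, haα ε₂ h₂, heq] at this
          rw [← this]
          simp
        have hz := (Finset.sum_eq_zero_iff_of_nonneg fun t _ => mul_nonneg (hl0 ε₁ h₁ t)
          (sub_nonneg.2 (hφle ε₂ h₂ t))).1 hsum t (Finset.mem_univ _)
        rcases mul_eq_zero.1 hz with h0 | h0
        · exact absurd h0 ((hla ε₁ h₁ t).2 ht)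
        · exact hφeq ε₂ h₂ t (by linarith)
      intro ε₁ h₁ ε₂ h₂ heq
      ext1 t
      have hiff : a ε₁ (ε₁ t • y t) = 1 ↔ a ε₂ (ε₂ t • y t) = 1 :=
        ⟨hfacet ε₁ h₁ ε₂ h₂ heq t, hfacet ε₂ h₂ ε₁ h₁ heq.symm t⟩
      have := congrFun heq t
      by_cases ht : a ε₂ (ε₂ t • y t) = 1
      · rwa [hφ₁ ht, hφ₁ (hiff.2 ht)] at this
      · rwa [hφ₂ ht, hφ₂ (mt hiff.1 ht), neg_inj] at this
  have := Finset.card_le_card_sdiff_add_card (s := Y) (t := Z)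
  omega

end

/-! ### Wendel's count -/

/-- The number of orthants of `ℝ^n` met by a subspace of dimension `d` in general position. -/
def wendelCount : ℕ → ℕ → ℕ
  | 0, _ => 1
  | _ + 1, 0 => 0
  | n + 1, d + 1 => wendelCount n (d + 1) + wendelCount n d

theorem wendelCount_succ (n d : ℕ) :
    wendelCount (n + 1) d = 2 * ∑ j ∈ Finset.range d, n.choose j := by
  induction n generalizing d with
  | zero =>
    cases d with
    | zero => simp [wendelCount]
    | succ d => simp [wendelCount, Finset.sum_range_succ']
  | succ n ih =>
    cases d with
    | zero => simp [wendelCount]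
    | succ d =>
      rw [wendelCount, ih, ih, Finset.sum_range_succ' (fun j => (n + 1).choose j),
        Finset.sum_range_succ' (fun j => n.choose j)]
      simp only [Nat.choose_succ_succ, Finset.sum_add_distrib, Nat.choose_zero_right]
      ring

/-- A functional that vanishes at `y 0` can be tilted slightly to give `y 0` either sign without
disturbing the finitely many strict inequalities. -/
theorem exists_pos_of_pos_of_eq_zero {n : ℕ} {E : Type*} [AddCommGroup E] [Module ℝ E]
    {y : Fin (n + 1) → E} (hy : y 0 ≠ 0) {ε : Fin n → ℤˣ} {v : E →ₗ[ℝ] ℝ}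
    (hv : ∀ t, 0 < v (ε t • y t.succ)) (hv0 : v (y 0) = 0) (σ : ℤˣ) :
    ∃ w : E →ₗ[ℝ] ℝ, ∀ t, 0 < w (Fin.cons (α := fun _ => ℤˣ) σ ε t • y t) := by
  obtain ⟨u, hu⟩ : ∃ u : E →ₗ[ℝ] ℝ, u (y 0) ≠ 0 := by
    by_contra! h
    exact hy ((Module.forall_dual_apply_eq_zero_iff ℝ _).1 h)
  have hev : ∀ᶠ δ : ℝ in nhds 0, ∀ t, 0 < (v + δ • u) (ε t • y t.succ) := by
    refine Filter.eventually_all.2 fun t => ?_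
    have hcont : Continuous fun δ : ℝ => (v + δ • u) (ε t • y t.succ) := by
      simp only [LinearMap.add_apply, LinearMap.smul_apply, smul_eq_mul]
      fun_prop
    exact hcont.continuousAt.eventually_const_lt (by simpa using hv t)
  obtain ⟨r, hr, hball⟩ := Metric.eventually_nhds_iff.1 hev
  have hsu : u (σ • y 0) ≠ 0 := by
    rcases Int.units_eq_one_or σ with rfl | rfl <;> simpa using hu
  set δ : ℝ := SignType.sign (u (σ • y 0)) * (r / 2) with hδ
  refine ⟨v + δ • u, Fin.cases ?_ fun t => ?_⟩
  · have h0 : v (σ • y 0) = 0 := by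
      rcases Int.units_eq_one_or σ with rfl | rfl <;> simpa using hv0
    have : δ * u (σ • y 0) = |u (σ • y 0)| * (r / 2) := by
      rw [hδ, mul_right_comm, sign_mul_self]
    simp only [Fin.cons_zero, LinearMap.add_apply, LinearMap.smul_apply, smul_eq_mul, h0, this]
    positivity
  · rw [Fin.cons_succ]
    refine hball ?_ t
    have : |(SignType.sign (u (σ • y 0)) : ℝ)| = 1 := by
      rcases hsu.lt_or_gt with h | h
      · rw [sign_neg h]; simp
      · rw [sign_pos h]; simp
    rw [Real.dist_eq, sub_zero, hδ, abs_mul, this, abs_of_pos (by positivity)]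
    linarith

open Classical in
/-- Wendel's count: among the sign changes of `n` vectors in general position in dimension `d`,
at least `wendelCount n d` lie in an open half-space. -/
theorem wendelCount_le_card {n : ℕ} {E : Type*} [AddCommGroup E] [Module ℝ E]
    [FiniteDimensional ℝ E] {y : Fin n → E}
    (hy : ∀ I : Finset (Fin n), I.card ≤ Module.finrank ℝ E → LinearIndepOn ℝ y I) :
    wendelCount n (Module.finrank ℝ E) ≤
      (Finset.univ.filter fun ε : Fin n → ℤˣ =>
        ∃ v : E →ₗ[ℝ] ℝ, ∀ t, 0 < v (ε t • y t)).card := by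
  induction n generalizing E with
  | zero => simp [wendelCount]
  | succ n ih =>
    rcases hd : Module.finrank ℝ E with _ | d
    · simp [wendelCount]
    have hy0 : y 0 ≠ 0 := by
      have := hy {0} (by simp [hd])
      rw [Finset.coe_singleton] at this
      exact this.ne_zero (Set.mem_singleton _)
    -- Every half-space sign pattern of the last `n` vectors extends to `y 0` in at least one way.
    -- The patterns realized by a functional vanishing at `y 0`, which are those of the quotient by
    -- `y 0`, extend in both ways. This is the recursion of `wendelCount`.
    set L := Submodule.span ℝ {y 0} with hL
    have hdL : Module.finrank ℝ (E ⧸ L) = d := by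
      have := L.finrank_quotient_add_finrank
      rw [finrank_span_singleton hy0, hd] at this
      omega
    have hA := ih (E := E) (y := fun t => y t.succ) fun I hI => by
      have := hy (I.map (Fin.succEmb n)) (by simpa using hI)
      rw [Finset.coe_map] at this
      exact this.comp_of_image (Fin.succ_injective n).injOn
    have hB := ih (E := E ⧸ L) (y := fun t => L.mkQ (y t.succ)) fun I hI => by
      have h := hy (insert 0 (I.map (Fin.succEmb n)))
        ((Finset.card_insert_le _ _).trans (by simp only [Finset.card_map]; omega))
      rw [Finset.coe_insert, Finset.coe_map, ← Set.singleton_union,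
        linearIndepOn_union_iff_quotient (by simp [Fin.succ_ne_zero]), Set.image_singleton] at h
      exact h.2.comp_of_image (Fin.succ_injective n).injOn
    rw [hd] at hA
    rw [hdL] at hB
    rw [wendelCount]
    refine (add_le_add hA hB).trans ?_
    have hσ : ∀ ε : Fin n → ℤˣ, (∃ v : E →ₗ[ℝ] ℝ, ∀ t, 0 < v (ε t • y t.succ)) →
        ∃ σ : ℤˣ, ∃ v : E →ₗ[ℝ] ℝ, ∀ t, 0 < v (Fin.cons (α := fun _ => ℤˣ) σ ε t • y t) := by
      rintro ε ⟨v, hv⟩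
      rcases lt_trichotomy (v (y 0)) 0 with h | h | h
      · exact ⟨-1, v, Fin.cases (by simpa using h) (by simpa using hv)⟩
      · exact ⟨1, exists_pos_of_pos_of_eq_zero hy0 hv h 1⟩
      · exact ⟨1, v, Fin.cases (by simpa using h) (by simpa using hv)⟩
    choose! σ hσ using hσ
    -- The extensions by `σ ε` account for the first summand and those by `-σ ε` for the second; the
    -- opposite sign at index `0` makes them disjoint.
    rw [← Finset.card_image_of_injective _ (f := fun ε => Fin.cons (α := fun _ => ℤˣ) (σ ε) ε)
        (fun ε ε' h => (Fin.cons_injective2 h).2),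
      ← Finset.card_image_of_injective (Finset.univ.filter fun ε : Fin n → ℤˣ =>
        ∃ v : (E ⧸ L) →ₗ[ℝ] ℝ, ∀ t, 0 < v (ε t • L.mkQ (y t.succ)))
        (f := fun ε => Fin.cons (α := fun _ => ℤˣ) (-σ ε) ε)
        (fun ε ε' h => (Fin.cons_injective2 h).2),
      ← Finset.card_union_of_disjoint]
    · refine Finset.card_le_card fun ε hε => ?_
      simp only [Finset.mem_union, Finset.mem_image, Finset.mem_filter, Finset.mem_univ,
        true_and] at hε ⊢
      rcases hε with ⟨ε', h, rfl⟩ | ⟨ε', ⟨v, hv⟩, rfl⟩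
      · exact hσ ε' h
      · refine exists_pos_of_pos_of_eq_zero hy0 (v := v ∘ₗ L.mkQ) (fun t => ?_) ?_ _
        · have := hv t
          rcases Int.units_eq_one_or (ε' t) with h | h <;> simpa [h] using this
        · have : L.mkQ (y 0) = 0 := by simp [hL, Submodule.mem_span_singleton_self]
          simp only [LinearMap.comp_apply, this, map_zero]
    · rw [Finset.disjoint_left]
      simp only [Finset.mem_image, not_exists, not_and]
      rintro _ ⟨ε, _, rfl⟩ ε' _ heq
      obtain ⟨h0, rfl⟩ := Fin.cons_injective2 heq
      exact neg_units_ne_self _ h0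

/-! ### Random points are almost surely in general position -/

/-- A linear relation becomes an affine one when the origin takes the weight that makes the total
zero. -/
theorem InGeneralPosition.linearIndepOn {ι E : Type*} [AddCommGroup E] [Module ℝ E]
    {p : E} {y : ι → E} (h : InGeneralPosition p y) {I : Finset ι}
    (hI : I.card ≤ Module.finrank ℝ E) : LinearIndepOn ℝ y I := by
  classical
  rw [linearIndepOn_finset_iff]
  intro g hg t ht
  let w : Option (Option ι) → ℝ
    | none => -∑ t ∈ I, g t
    | some none => 0
    | some (some t) => g t
  have hJ := h (Finset.insertNone (I.map .some)) (by simpa using hI)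
  refine affineIndependent_iff.1 hJ Finset.univ (fun j => w j) ?_ ?_
    ⟨some (some t), by simpa using ht⟩ (Finset.mem_univ _)
  · rw [Finset.sum_coe_sort _ w]
    simp [Finset.sum_insertNone, w]
  · rw [Finset.sum_coe_sort _ (fun j => w j • originAndPoints p y j)]
    simpa [Finset.sum_insertNone, w, originAndPoints] using hg

theorem affineIndependent_finset_of_erase {κ E : Type*} [DecidableEq κ] [AddCommGroup E]
    [Module ℝ E] {f : κ → E} {J : Finset κ} {i : κ}
    (h : AffineIndependent ℝ fun j : J.erase i => f j)
    (hi : i ∈ J → f i ∉ affineSpan ℝ (Set.range fun j : J.erase i => f j)) :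
    AffineIndependent ℝ fun j : J => f j := by
  by_cases hiJ : i ∈ J
  · refine AffineIndependent.affineIndependent_of_notMem_span (i := ⟨i, hiJ⟩) ?_ ?_
    · let e : {j : J // j ≠ ⟨i, hiJ⟩} ↪ J.erase i :=
        ⟨fun j => ⟨j.1.1, Finset.mem_erase.2 ⟨fun h => j.2 (Subtype.ext h), j.1.2⟩⟩,
          fun a b hab => Subtype.ext (Subtype.ext (congrArg (fun z => z.1) hab))⟩
      exact h.comp_embedding e
    · refine fun hmem => hi hiJ (affineSpan_mono ℝ ?_ hmem)
      rintro _ ⟨j, hj, rfl⟩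
      exact ⟨⟨j.1, Finset.mem_erase.2 ⟨fun h => hj (Subtype.ext h), j.2⟩⟩, rfl⟩
  · rwa [Finset.erase_eq_of_notMem hiJ] at h

theorem exists_dual_eq_of_ne_top {E : Type*} [AddCommGroup E] [Module ℝ E]
    {S : AffineSubspace ℝ E} (hS : S ≠ ⊤) (hne : (S : Set E).Nonempty) :
    ∃ a : E →ₗ[ℝ] ℝ, a ≠ 0 ∧ ∃ c, ∀ x ∈ S, a x = c := by
  obtain ⟨x₀, hx₀⟩ := hne
  have hdir : S.direction ≠ ⊤ := by
    rwa [Ne, AffineSubspace.direction_eq_top_iff_of_nonempty ⟨x₀, hx₀⟩]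
  obtain ⟨a, ha, hker⟩ := S.direction.exists_le_ker_of_lt_top (lt_top_iff_ne_top.2 hdir)
  refine ⟨a, ha, a x₀, fun x hx => ?_⟩
  have : a (x - x₀) = 0 := hker (AffineSubspace.vsub_mem_direction hx hx₀)
  rwa [map_sub, sub_eq_zero] at this

theorem isOpen_setOf_affineIndependent_points {ι E : Type*} [Fintype ι] [NormedAddCommGroup E]
    [NormedSpace ℝ E] (p : E) (ε : ι → ℤˣ)
    (J : Finset (Option (Option ι))) :
    IsOpen {y : ι → E | AffineIndependent ℝ
      fun j : J => originAndPoints p (fun t => ε t • y t) j} := by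
  refine isOpen_setOfPred_affineIndependent.preimage (f := fun y : ι → E =>
    fun j : J => originAndPoints p (fun t => ε t • y t) j) (continuous_pi ?_)
  rintro ⟨_ | _ | t, hj⟩
  · exact continuous_const
  · exact continuous_const
  · simp only [originAndPoints, Units.smul_def]
    fun_prop

theorem measure_setOf_smul_mem_eq_zero {E : Type*} [AddCommGroup E] [Module ℝ E]
    [MeasurableSpace E] {Q : Measure E}
    (hQ : ∀ a : E →ₗ[ℝ] ℝ, a ≠ 0 → ∀ c, Q {x | a x = c} = 0)
    {S : AffineSubspace ℝ E} (hS : S ≠ ⊤) (σ : ℤˣ) : Q {x | σ • x ∈ S} = 0 := by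
  rcases (S : Set E).eq_empty_or_nonempty with h | h
  · have : {x : E | σ • x ∈ S} = ∅ := by
      ext x
      exact ⟨fun hx => (h ▸ hx : σ • x ∈ (∅ : Set E)), fun hx => hx.elim⟩
    simp [this]
  · obtain ⟨a, ha, c, hc⟩ := exists_dual_eq_of_ne_top hS h
    refine measure_mono_null (fun x hx => ?_) (hQ a ha (σ • c))
    have := hc _ hx
    rcases Int.units_eq_one_or σ with rfl | rfl
    · simpa using this
    · simp only [Units.neg_smul, one_smul, map_neg] at this
      simp [← this]

section
variable {ι E : Type*} [Fintype ι] [NormedAddCommGroup E] [NormedSpace ℝ E]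
  [FiniteDimensional ℝ E] [MeasurableSpace E] [BorelSpace E]
  {Q : Measure E} {p : E}

/-- Induction removes one random point at a time. At most `finrank` points remain, so their affine
span is proper, and conditionally on them the removed point almost surely avoids it. The induction
ends with a subset of `{0, p}`, where `p ≠ 0` is used. -/
theorem ae_affineIndependent_points [IsProbabilityMeasure Q]
    (hQ : ∀ a : E →ₗ[ℝ] ℝ, a ≠ 0 → ∀ c, Q {x | a x = c} = 0) (hp : p ≠ 0) (ε : ι → ℤˣ)
    (J : Finset (Option (Option ι))) (hJ : J.card ≤ Module.finrank ℝ E + 1) :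
    ∀ᵐ y ∂Measure.pi (fun _ : ι => Q), AffineIndependent ℝ
      fun j : J => originAndPoints p (fun t => ε t • y t) j := by
  classical
  induction J using Finset.strongInduction with
  | H J ih =>
    by_cases h : ∃ t, some (some t) ∈ J
    · obtain ⟨t, ht⟩ := h
      set J' := J.erase (some (some t)) with hJ'
      have hcard : J'.card < J.card := Finset.card_erase_lt_of_mem ht
      have hind := ih J' (Finset.erase_ssubset ht) (by omega)
      set G := {y : ι → E | AffineIndependent ℝ
        fun j : J' => originAndPoints p (fun t => ε t • y t) j} with hG
      set B := {y : ι → E | AffineIndependent ℝ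
        fun j : J => originAndPoints p (fun t => ε t • y t) j}ᶜ with hB
      have hGm : MeasurableSet G := (isOpen_setOf_affineIndependent_points p ε J').measurableSet
      have hBm : MeasurableSet B :=
        (isOpen_setOf_affineIndependent_points p ε J).measurableSet.compl
      have hcongr : ∀ (y : ι → E) (x : E) (j : J'),
          originAndPoints p (fun s => ε s • Function.update y t x s) j =
            originAndPoints p (fun s => ε s • y s) j := by
        rintro y x ⟨_ | _ | s, hj⟩
        · rfl
        · rfl
        · have hst : s ≠ t := by
            rintro rfl
            simp [hJ'] at hj
          simp [originAndPoints, hst]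
      have hinner : ∀ y : ι → E, Q {x | Function.update y t x ∈ B ∩ G} = 0 := by
        intro y
        by_cases hy : y ∈ G
        · have hS : affineSpan ℝ (Set.range fun j : J' =>
              originAndPoints p (fun s => ε s • y s) j) ≠ ⊤ := by
            rw [Ne, AffineIndependent.affineSpan_eq_top_iff_card_eq_finrank_add_one hy,
              Fintype.card_coe]
            omega
          refine measure_mono_null (fun x hx => ?_) (measure_setOf_smul_mem_eq_zero hQ hS (ε t))
          by_contra hmem
          refine hx.1 (affineIndependent_finset_of_erase hx.2 fun _ => ?_)
          have hx' : originAndPoints p (fun s => ε s • Function.update y t x s) (some (some t)) =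
              ε t • x := by simp [originAndPoints]
          rw [hx']
          simp only [hcongr]
          exact hmem
        · have : {x | Function.update y t x ∈ B ∩ G} = ∅ := by
            ext x
            simp only [Set.mem_ofPred_eq, Set.mem_empty_iff_false, iff_false]
            rintro ⟨_, hx⟩
            apply hy
            simpa only [hG, Set.mem_ofPred_eq, hcongr] using hx
          rw [this, measure_empty]
      have hBG : Measure.pi (fun _ : ι => Q) (B ∩ G) = 0 := by
        rw [← lintegral_indicator_one (hBm.inter hGm)]
        have := lintegral_eq_of_lmarginal_eq (μ := fun _ : ι => Q) {t}
          (f := (B ∩ G).indicator 1) (g := 0)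
          (measurable_one.indicator (hBm.inter hGm)) measurable_zero (by
            rw [lmarginal_singleton, lmarginal_singleton]
            ext y
            have hm : MeasurableSet {x | Function.update y t x ∈ B ∩ G} :=
              (measurable_update y) (hBm.inter hGm)
            have : (fun x => (B ∩ G).indicator (1 : (ι → E) → ENNReal) (Function.update y t x)) =
                {x | Function.update y t x ∈ B ∩ G}.indicator 1 := by
              ext x
              by_cases hx : Function.update y t x ∈ B ∩ G
              · rw [Set.indicator_of_mem hx, Set.indicator_of_mem (Set.mem_ofPred_eq.symm ▸ hx)]
                rfl
              · rw [Set.indicator_of_notMem hx]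
                exact (Set.indicator_of_notMem
                  (s := {x | Function.update y t x ∈ B ∩ G}) hx 1).symm
            rw [this, lintegral_indicator_one hm, hinner]
            simp)
        simpa using this
      rw [ae_iff] at hind ⊢
      refine measure_mono_null (fun y hy => ?_) (measure_union_null hBG hind)
      by_cases hyG : y ∈ G
      · exact Or.inl ⟨hy, hyG⟩
      · exact Or.inr hyG
    · have hno : ∀ t, some (some t) ∉ J := fun t ht => h ⟨t, ht⟩
      refine Filter.Eventually.of_forall fun y => ?_
      let e : J ↪ Fin 2 := ⟨fun j => if j.1 = none then 0 else 1, by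
        rintro ⟨_ | _ | t, hj⟩ ⟨_ | _ | s, hk⟩ hjk
          <;> first
            | rfl
            | exact absurd hj (hno _)
            | exact absurd hk (hno _)
            | simp at hjk⟩
      have hcomp : (fun j : J => originAndPoints p (fun t => ε t • y t) j) = ![0, p] ∘ e := by
        funext j
        obtain ⟨_ | _ | t, hj⟩ := j
        · rfl
        · rfl
        · exact absurd hj (hno _)
      rw [hcomp]
      exact (affineIndependent_of_ne ℝ hp.symm).comp_embedding e

theorem ae_inGeneralPosition [IsProbabilityMeasure Q]
    (hQ : ∀ a : E →ₗ[ℝ] ℝ, a ≠ 0 → ∀ c, Q {x | a x = c} = 0) (hp : p ≠ 0) :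
    ∀ᵐ y ∂Measure.pi (fun _ : ι => Q), ∀ ε : ι → ℤˣ,
      InGeneralPosition p fun t => ε t • y t := by
  refine ae_all_iff.2 fun ε => ?_
  have : ∀ᵐ y ∂Measure.pi (fun _ : ι => Q), ∀ J : Finset (Option (Option ι)),
      J.card ≤ Module.finrank ℝ E + 1 → AffineIndependent ℝ
        fun j : J => originAndPoints p (fun t => ε t • y t) j := by
    refine ae_all_iff.2 fun J => ?_
    by_cases hJ : J.card ≤ Module.finrank ℝ E + 1
    · filter_upwards [ae_affineIndependent_points hQ hp ε J hJ] with y hy _ using hy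
    · exact .of_forall fun y h => absurd h hJ
  exact this

end

/-! ### From sign counts to probabilities -/

open Classical in
theorem card_mem_convexHull_add_wendelCount_le {n : ℕ} {E : Type*} [NormedAddCommGroup E]
    [NormedSpace ℝ E] [FiniteDimensional ℝ E] {y : Fin n → E}
    (hy : ∀ I : Finset (Fin n), I.card ≤ Module.finrank ℝ E → LinearIndepOn ℝ y I) :
    (Finset.univ.filter fun ε : Fin n → ℤˣ =>
      (0 : E) ∈ convexHull ℝ (Set.range fun t => ε t • y t)).card +
        wendelCount n (Module.finrank ℝ E) ≤ 2 ^ n := by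
  have h := wendelCount_le_card hy
  have htot : Fintype.card (Fin n → ℤˣ) = 2 ^ n := by simp
  rw [← htot, ← Finset.card_univ]
  refine (Nat.add_le_add_left h _).trans ?_
  rw [← Finset.card_union_of_disjoint]
  · exact Finset.card_le_card (Finset.subset_univ _)
  · rw [Finset.disjoint_left]
    simp only [Finset.mem_filter, Finset.mem_univ, true_and, not_exists]
    intro ε h0 v hv
    have : (0 : E) ∈ {x | 0 < v x} :=
      convexHull_min (by rintro _ ⟨t, rfl⟩; exact hv t) (convex_halfSpace_gt v.isLinear 0) h0
    simp at this

theorem notMem_convexHull_range_iff {ι E : Type*} [Finite ι] [NormedAddCommGroup E]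
    [NormedSpace ℝ E] {y : ι → E} {p : E} :
    p ∉ convexHull ℝ (Set.range y) ↔ ∃ a : StrongDual ℝ E, ∀ t, a p < a (y t) := by
  constructor
  · intro hp
    obtain ⟨a, u, h1, h2⟩ := geometric_hahn_banach_point_closed (convex_convexHull ℝ _)
      ((Set.finite_range y).isCompact_convexHull ℝ).isClosed hp
    exact ⟨a, fun t => h1.trans (h2 _ (subset_convexHull ℝ _ ⟨t, rfl⟩))⟩
  · rintro ⟨a, ha⟩ hp
    have : p ∈ {x | a p < a x} :=
      convexHull_min (by rintro _ ⟨t, rfl⟩; exact ha t)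
        (convex_halfSpace_gt a.toLinearMap.isLinear _) hp
    simp at this

theorem isOpen_setOf_notMem_convexHull_range {ι E : Type*} [Finite ι] [NormedAddCommGroup E]
    [NormedSpace ℝ E] (p : E) : IsOpen {y : ι → E | p ∉ convexHull ℝ (Set.range y)} := by
  simp only [notMem_convexHull_range_iff, Set.ofPred_exists, Set.ofPred_forall]
  exact isOpen_iUnion fun a => isOpen_iInter_of_finite fun t =>
    isOpen_lt continuous_const (by fun_prop)

/-- For independent points with a common symmetric law that charges no hyperplane, the convex hull
misses any given point with at least the probability of Wendel's formula. -/
theorem wendelCount_le_measureReal_notMem_convexHull {n : ℕ} {E : Type*} [NormedAddCommGroup E]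
    [NormedSpace ℝ E] [FiniteDimensional ℝ E] [Nontrivial E] [MeasurableSpace E] [BorelSpace E]
    {Q : Measure E} [IsProbabilityMeasure Q]
    (hQ : ∀ a : E →ₗ[ℝ] ℝ, a ≠ 0 → ∀ c, Q {x | a x = c} = 0)
    (hsymm : Q.map (fun x => -x) = Q) (p : E) :
    (wendelCount n (Module.finrank ℝ E) : ℝ) / 2 ^ n ≤
      (Measure.pi fun _ : Fin n => Q).real {y | p ∉ convexHull ℝ (Set.range y)} := by
  classical
  set π := Measure.pi fun _ : Fin n => Q
  set C : Set (Fin n → E) := {y | p ∉ convexHull ℝ (Set.range y)} with hC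
  have hCm : MeasurableSet C := (isOpen_setOf_notMem_convexHull_range p).measurableSet
  have hpres : ∀ ε : Fin n → ℤˣ, MeasurePreserving (fun (y : Fin n → E) t => ε t • y t) π π := by
    intro ε
    refine measurePreserving_pi _ _ fun t => ?_
    rcases Int.units_eq_one_or (ε t) with h | h
    · have : (fun x : E => ε t • x) = id := by ext x; simp [h]
      change MeasurePreserving (fun x : E => ε t • x) Q Q
      rw [this]
      exact MeasurePreserving.id Q
    · have : (fun x : E => ε t • x) = fun x => -x := by ext x; simp [h]
      change MeasurePreserving (fun x : E => ε t • x) Q Q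
      rw [this]
      exact ⟨measurable_neg, hsymm⟩
  -- The count holds for almost every fixed `y`. Each sign change preserves `π`, so integrating the
  -- sum yields `2 ^ n` times the probability of `C`.
  have hcount : ∀ᵐ y ∂π, (wendelCount n (Module.finrank ℝ E) : ℝ) ≤
      ∑ ε : Fin n → ℤˣ, ((fun (y : Fin n → E) t => ε t • y t) ⁻¹' C).indicator 1 y := by
    -- General position fails when its reference point is the origin, so for `p = 0` an arbitrary
    -- nonzero `q` replaces it.
    obtain ⟨q, hq, hpq⟩ : ∃ q : E, q ≠ 0 ∧ (p ≠ 0 → q = p) := by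
      by_cases hp : p = 0
      · obtain ⟨q, hq⟩ := exists_ne (0 : E)
        exact ⟨q, hq, fun h => absurd hp h⟩
      · exact ⟨p, hp, fun _ => rfl⟩
    filter_upwards [ae_inGeneralPosition (ι := Fin n) hQ hq] with y hy
    have h0 := card_mem_convexHull_add_wendelCount_le fun I hI => by
      simpa using (hy 1).linearIndepOn hI
    have hle : (Finset.univ.filter fun ε : Fin n → ℤˣ =>
        p ∈ convexHull ℝ (Set.range fun t => ε t • y t)).card ≤
      (Finset.univ.filter fun ε : Fin n → ℤˣ =>
        (0 : E) ∈ convexHull ℝ (Set.range fun t => ε t • y t)).card := by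
      by_cases hp : p = 0
      · rw [hp]
      · have := hpq hp
        subst this
        exact card_mem_convexHull_le hy
    have hsum := Finset.card_filter_add_card_filter_not (s := Finset.univ)
      (fun ε : Fin n → ℤˣ => p ∈ convexHull ℝ (Set.range fun t => ε t • y t))
    have htot : (Finset.univ : Finset (Fin n → ℤˣ)).card = 2 ^ n := by simp
    have hfin : wendelCount n (Module.finrank ℝ E) ≤
        (Finset.univ.filter fun ε : Fin n → ℤˣ =>
          ¬ p ∈ convexHull ℝ (Set.range fun t => ε t • y t)).card := by omega
    have heq : ∑ ε : Fin n → ℤˣ, ((fun (y : Fin n → E) t => ε t • y t) ⁻¹' C).indicator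
        (1 : (Fin n → E) → ℝ) y = (Finset.univ.filter fun ε : Fin n → ℤˣ =>
          ¬ p ∈ convexHull ℝ (Set.range fun t => ε t • y t)).card := by
      rw [Finset.card_filter]
      push_cast
      exact Finset.sum_congr rfl fun ε _ => by
        simp only [Set.indicator, hC, Set.mem_preimage, Set.mem_ofPred_eq, Pi.one_apply]
    rw [heq]
    exact_mod_cast hfin
  have hint : ∀ ε : Fin n → ℤˣ, Integrable
      (((fun (y : Fin n → E) t => ε t • y t) ⁻¹' C).indicator (1 : (Fin n → E) → ℝ)) π :=
    fun ε => (integrable_const (1 : ℝ)).indicator ((hpres ε).measurable hCm)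
  have h1 : (wendelCount n (Module.finrank ℝ E) : ℝ) ≤ ∫ y, ∑ ε : Fin n → ℤˣ,
      ((fun (y : Fin n → E) t => ε t • y t) ⁻¹' C).indicator (1 : (Fin n → E) → ℝ) y ∂π := by
    have := integral_mono_ae (integrable_const _) (integrable_finsetSum _ fun ε _ => hint ε) hcount
    simpa using this
  rw [integral_finsetSum _ fun ε _ => hint ε] at h1
  have h2 : ∀ ε : Fin n → ℤˣ, ∫ y, ((fun (y : Fin n → E) t => ε t • y t) ⁻¹' C).indicator
      (1 : (Fin n → E) → ℝ) y ∂π = π.real C := by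
    intro ε
    rw [integral_indicator_one ((hpres ε).measurable hCm), measureReal_def,
      (hpres ε).measure_preimage hCm.nullMeasurableSet, measureReal_def]
  simp only [h2] at h1
  rw [div_le_iff₀ (by positivity)]
  simpa [mul_comm] using h1

/-! ### Spherical laws charge no hyperplane -/

open scoped RealInnerProductSpace

/-- Dominated convergence of the indicators. The sets will be hyperplanes of equal measure, of which
almost every point lies on only finitely many. -/
theorem measure_eq_zero_of_forall_eventually_notMem {α : Type*} [MeasurableSpace α]
    {ν : Measure α} [IsFiniteMeasure ν] {S : ℕ → Set α} (hS : ∀ k, MeasurableSet (S k))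
    {q : ENNReal} (hq : ∀ k, ν (S k) = q)
    (h : ∀ᵐ x ∂ν, ∀ᶠ k in Filter.atTop, x ∉ S k) : q = 0 := by
  have := tendsto_measure_of_ae_tendsto_indicator_of_isFiniteMeasure (μ := ν) Filter.atTop
    MeasurableSet.empty hS (by filter_upwards [h] with x hx; simpa using hx)
  simp only [hq, measure_empty] at this
  exact tendsto_nhds_unique tendsto_const_nhds this

theorem Polynomial.eventually_eval_natCast_ne_zero {f : Polynomial ℝ} (hf : f ≠ 0) :
    ∀ᶠ k : ℕ in Filter.atTop, f.eval (k : ℝ) ≠ 0 := by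
  filter_upwards [tendsto_natCast_atTop_atTop.eventually (f.eventually_atTop_not_isRoot hf)] with k hk
  exact hk

namespace IsSpherical

variable {N : ℕ} {ν : Measure (EuclideanSpace ℝ (Fin N))}

theorem measure_inner_eq_congr (hν : IsSpherical ν) {v w : EuclideanSpace ℝ (Fin N)}
    (h : ‖v‖ = ‖w‖) (c : ℝ) : ν {x | ⟪v, x⟫ = c} = ν {x | ⟪w, x⟫ = c} := by
  set U := (Submodule.span ℝ {v - w})ᗮ.reflection
  have hU : U v = w := Submodule.reflection_sub h
  have hm : MeasurableSet {x : EuclideanSpace ℝ (Fin N) | ⟪w, x⟫ = c} :=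
    (isClosed_eq (by fun_prop) continuous_const).measurableSet
  conv_rhs => rw [← hν U, Measure.map_apply U.continuous.measurable hm]
  congr 1
  ext x
  simp only [Set.mem_preimage, Set.mem_ofPred_eq, ← hU, U.inner_map_map]

theorem measure_inner_eq_zero_eq_zero [IsProbabilityMeasure ν] (hν : IsSpherical ν)
    (h0 : ν {0} = 0) {v : EuclideanSpace ℝ (Fin N)} (hv : v ≠ 0) : ν {x | ⟪v, x⟫ = 0} = 0 := by
  -- Normals on the moment curve: `⟪u k, x⟫` is the value at `k` of the polynomial with coefficients
  -- `x i`, so `x ≠ 0` is orthogonal to only finitely many of them.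
  let u : ℕ → EuclideanSpace ℝ (Fin N) := fun k => WithLp.toLp 2 fun i => (k : ℝ) ^ (i : ℕ)
  have hN : 0 < N := by
    rcases Nat.eq_zero_or_pos N with rfl | h
    · exact absurd (Subsingleton.elim v 0) hv
    · exact h
  have hu : ∀ k, u k ≠ 0 := fun k h => by
    have := congrArg (fun x : EuclideanSpace ℝ (Fin N) => x ⟨0, hN⟩) h
    simp [u] at this
  have hnorm : ∀ k, ‖(‖v‖ / ‖u k‖) • u k‖ = ‖v‖ := fun k => by
    rw [norm_smul, norm_div, norm_norm, norm_norm, div_mul_cancel₀ _ (norm_ne_zero_iff.2 (hu k))]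
  refine measure_eq_zero_of_forall_eventually_notMem (ν := ν)
    (S := fun k => {x | ⟪(‖v‖ / ‖u k‖) • u k, x⟫ = 0})
    (fun k => (isClosed_eq (by fun_prop) continuous_const).measurableSet)
    (fun k => hν.measure_inner_eq_congr (hnorm k) 0) ?_
  have hne : ∀ᵐ x ∂ν, x ≠ 0 := by
    rw [ae_iff]
    simpa using h0
  filter_upwards [hne] with x hx
  let f : Polynomial ℝ := ∑ i : Fin N, Polynomial.monomial (i : ℕ) (x i)
  have hf : f ≠ 0 := by
    intro hf
    apply hx
    ext j
    have := congrArg (fun g => Polynomial.coeff g (j : ℕ)) hf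
    simpa [f, Polynomial.finsetSum_coeff, Polynomial.coeff_monomial, Fin.val_inj] using this
  filter_upwards [Polynomial.eventually_eval_natCast_ne_zero hf] with k hk hmem
  apply hk
  have hmem' : (‖v‖ / ‖u k‖) * ⟪u k, x⟫ = 0 := by
    rw [← real_inner_smul_left]
    exact hmem
  rcases mul_eq_zero.1 hmem' with h | h
  · exact absurd h (div_ne_zero (norm_ne_zero_iff.2 hv) (norm_ne_zero_iff.2 (hu k)))
  · simpa [f, Polynomial.eval_finsetSum, PiLp.inner_apply, u] using h

theorem measure_inner_eq_eq_zero_of_ne_zero [IsProbabilityMeasure ν] (hν : IsSpherical ν)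
    (hN : 2 ≤ N) {v : EuclideanSpace ℝ (Fin N)} (hv : v ≠ 0) {c : ℝ} (hc : c ≠ 0) :
    ν {x | ⟪v, x⟫ = c} = 0 := by
  obtain ⟨e, hev, he⟩ : ∃ e : EuclideanSpace ℝ (Fin N), ⟪v, e⟫ = 0 ∧ ‖e‖ = ‖v‖ := by
    have hne : (Submodule.span ℝ {v})ᗮ ≠ ⊥ := by
      intro h
      have h1 := (Submodule.span ℝ {v}).finrank_add_finrank_orthogonal
      rw [h, finrank_span_singleton hv, finrank_bot, finrank_euclideanSpace_fin] at h1
      omega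
    obtain ⟨e, he, he0⟩ := Submodule.exists_mem_ne_zero_of_ne_bot hne
    refine ⟨(‖v‖ / ‖e‖) • e, ?_, ?_⟩
    · rw [real_inner_smul_right, Submodule.mem_orthogonal_singleton_iff_inner_right.1 he, mul_zero]
    · rw [norm_smul, norm_div, norm_norm, norm_norm, div_mul_cancel₀ _ (norm_ne_zero_iff.2 he0)]
  -- The rational parametrization of the circle through `v` and `e`. Clearing denominators makes `⟪w
  -- k, x⟫ = c` a quadratic equation in `k`, which is nontrivial because `c ≠ 0`.
  let w : ℕ → EuclideanSpace ℝ (Fin N) := fun k =>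
    (1 + (k : ℝ) ^ 2)⁻¹ • ((1 - (k : ℝ) ^ 2) • v + (2 * (k : ℝ)) • e)
  have hpos : ∀ k : ℕ, 0 < 1 + (k : ℝ) ^ 2 := fun k => by positivity
  have hnorm : ∀ k, ‖w k‖ = ‖v‖ := fun k => by
    have : ‖(1 - (k : ℝ) ^ 2) • v + (2 * (k : ℝ)) • e‖ ^ 2 = ((1 + (k : ℝ) ^ 2) * ‖v‖) ^ 2 := by
      rw [norm_add_sq_real, norm_smul, norm_smul, real_inner_smul_left, real_inner_smul_right,
        hev, he, mul_pow, mul_pow, Real.norm_eq_abs, Real.norm_eq_abs, sq_abs, sq_abs]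
      ring
    rw [sq_eq_sq₀ (norm_nonneg _) (mul_nonneg (hpos k).le (norm_nonneg _))] at this
    rw [norm_smul, this, norm_inv, Real.norm_of_nonneg (hpos k).le,
      inv_mul_cancel_left₀ (hpos k).ne']
  refine measure_eq_zero_of_forall_eventually_notMem (ν := ν) (S := fun k => {x | ⟪w k, x⟫ = c})
    (fun k => (isClosed_eq (by fun_prop) continuous_const).measurableSet)
    (fun k => hν.measure_inner_eq_congr (hnorm k) c) (.of_forall fun x => ?_)
  let f : Polynomial ℝ := Polynomial.C (⟪v, x⟫ - c) + Polynomial.C (2 * ⟪e, x⟫) * Polynomial.X +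
    Polynomial.C (-⟪v, x⟫ - c) * Polynomial.X ^ 2
  have hf : f ≠ 0 := by
    intro hf
    have h0 := congrArg (fun g => Polynomial.eval 0 g) hf
    have h1 := congrArg (fun g => Polynomial.eval 1 g) hf
    have h2 := congrArg (fun g => Polynomial.eval (-1) g) hf
    simp [f] at h0 h1 h2
    apply hc
    linarith
  filter_upwards [Polynomial.eventually_eval_natCast_ne_zero hf] with k hk hmem
  apply hk
  have hmem' : (1 + (k : ℝ) ^ 2)⁻¹ * ((1 - (k : ℝ) ^ 2) * ⟪v, x⟫ + 2 * k * ⟪e, x⟫) = c := by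
    rw [← real_inner_smul_left, ← real_inner_smul_left, ← inner_add_left, ← real_inner_smul_left]
    exact hmem
  rw [inv_mul_eq_iff_eq_mul₀ (hpos k).ne'] at hmem'
  simp only [f, Polynomial.eval_add, Polynomial.eval_mul, Polynomial.eval_C, Polynomial.eval_X,
    Polynomial.eval_pow]
  linarith

theorem measure_dual_eq_eq_zero [IsProbabilityMeasure ν] (hν : IsSpherical ν) (h0 : ν {0} = 0)
    (hN : 2 ≤ N) {b : StrongDual ℝ (EuclideanSpace ℝ (Fin N))} (hb : b ≠ 0) (c : ℝ) :
    ν {x | b x = c} = 0 := by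
  set v := (InnerProductSpace.toDual ℝ _).symm b with hv
  have hv0 : v ≠ 0 := by simpa [hv] using hb
  have heq : {x | b x = c} = {x | ⟪v, x⟫ = c} := by
    ext x
    simp [hv]
  rw [heq]
  by_cases hc : c = 0
  · rw [hc]
    exact hν.measure_inner_eq_zero_eq_zero h0 hv0
  · exact hν.measure_inner_eq_eq_zero_of_ne_zero hN hv0 hc

end IsSpherical

/-! ### Coherent measures and the final estimate -/

theorem not_isFeasible_of_forall_pos {N T : ℕ} {X : Matrix (Fin N) (Fin T) ℝ} {u : Fin N → ℝ}
    (hu : ∑ i, u i = 0) (hpos : ∀ t, 0 < portfolioReturn u X t)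
    {ρ : (Fin N → ℝ) → Matrix (Fin N) (Fin T) ℝ → ℝ} (hρ : IsCoherentOn ρ X) :
    ¬ IsFeasible ρ X := by
  rintro ⟨w, hw, hmin⟩
  -- With this shift, nonnegative returns of `w + b • u` on `X + a` force its risk on `X` to be at
  -- most `ρ w X - 1`. The sum `b` is large enough for every period at once.
  set a := ρ w X - 1 with ha
  set b := ∑ t, |portfolioReturn w X t + a| / portfolioReturn u X t with hb
  have hnorm : IsNormalized (w + b • u) := by
    simpa [IsNormalized, Finset.sum_add_distrib, ← Finset.mul_sum, hu] using hw
  have hret : ∀ t, portfolioReturn (w + b • u) (shiftSample X a) t =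
      portfolioReturn w X t + a + b * portfolioReturn u X t := by
    intro t
    have h1 : ∑ i, (w i + b * u i) = 1 := hnorm
    simp only [portfolioReturn, shiftSample, Matrix.of_apply, Pi.add_apply, Pi.smul_apply,
      smul_eq_mul, mul_add, Finset.sum_add_distrib, ← Finset.sum_mul, h1]
    simp only [add_mul, Finset.sum_add_distrib, mul_assoc, ← Finset.mul_sum]
    ring
  have h1 := hρ.monotonicity a (w + b • u) fun t => by
    have hle : |portfolioReturn w X t + a| / portfolioReturn u X t ≤ b :=
      Finset.single_le_sum (f := fun t => |portfolioReturn w X t + a| / portfolioReturn u X t)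
        (fun s _ => div_nonneg (abs_nonneg _) (hpos s).le) (Finset.mem_univ t)
    rw [div_le_iff₀ (hpos t)] at hle
    rw [hret]
    linarith [neg_abs_le (portfolioReturn w X t + a)]
  rw [hρ.translational_invariance a _ hnorm] at h1
  linarith [hmin _ hnorm]

/-- The complementary part of the binomial sum, out of the total `2 ^ n`, is half of `wendelCount (n
+ 1) d`. -/
theorem one_sub_minimaxProb (d n : ℕ) :
    1 - minimaxProb (d + 1) (n + 1) = (wendelCount (n + 1) d : ℝ) / 2 ^ (n + 1) := by
  have hsum : (∑ j ∈ Finset.range d, (n.choose j : ℝ)) +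
      (if d ≤ n then 1 else 0) * ∑ k ∈ Finset.Icc d n, (n.choose k : ℝ) = 2 ^ n := by
    have htot : ∑ j ∈ Finset.range (n + 1), (n.choose j : ℝ) = 2 ^ n := by
      exact_mod_cast Nat.sum_range_choose n
    split_ifs with h
    · rw [one_mul, ← htot, ← Finset.sum_range_add_sum_Ico _ (show d ≤ n + 1 by omega)]
      rfl
    · rw [zero_mul, add_zero, ← htot]
      refine (Finset.sum_subset (Finset.range_mono (by omega)) fun j _ hj => ?_).symm
      rw [Nat.choose_eq_zero_of_lt (by simpa using hj), Nat.cast_zero]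
  rw [wendelCount_succ, minimaxProb]
  simp only [Nat.add_sub_cancel]
  push_cast
  rw [pow_succ]
  field_simp
  linarith

/-- The zero-sum portfolios. -/
noncomputable def zeroSumSubspace (N : ℕ) : Submodule ℝ (EuclideanSpace ℝ (Fin N)) :=
  (Submodule.span ℝ {WithLp.toLp 2 fun _ => (1 : ℝ)})ᗮ

theorem sum_eq_zero_of_mem_zeroSumSubspace {N : ℕ} {u : EuclideanSpace ℝ (Fin N)}
    (hu : u ∈ zeroSumSubspace N) : ∑ i, u i = 0 := by
  have := Submodule.mem_orthogonal_singleton_iff_inner_right.1 hu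
  simpa [PiLp.inner_apply] using this

theorem finrank_zeroSumSubspace (d : ℕ) : Module.finrank ℝ (zeroSumSubspace (d + 1)) = d := by
  have : Fact (Module.finrank ℝ (EuclideanSpace ℝ (Fin (d + 1))) = d + 1) := ⟨by simp⟩
  refine Submodule.finrank_orthogonal_span_singleton (n := d) fun h => ?_
  have := congrArg (fun x : EuclideanSpace ℝ (Fin (d + 1)) => x 0) h
  simp at this

/-- The optimization problem is infeasible as soon as the projections of the columns onto the
zero-sum portfolios lie in an open half-space. -/
theorem not_isFeasible_of_notMem_convexHull {N T : ℕ} {x : Fin T → EuclideanSpace ℝ (Fin N)}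
    {m : EuclideanSpace ℝ (Fin N)}
    (hx : (-(zeroSumSubspace N).orthogonalProjectionOnto m : zeroSumSubspace N) ∉ convexHull ℝ
      (Set.range fun t => (zeroSumSubspace N).orthogonalProjectionOnto (x t - m)))
    {ρ : (Fin N → ℝ) → Matrix (Fin N) (Fin T) ℝ → ℝ} (hρ : IsCoherentOn ρ (sampleMatrix x)) :
    ¬ IsFeasible ρ (sampleMatrix x) := by
  obtain ⟨a, ha⟩ := notMem_convexHull_range_iff.1 hx
  set u := (InnerProductSpace.toDual ℝ (zeroSumSubspace N)).symm a with hu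
  refine not_isFeasible_of_forall_pos (u := fun i => (u : EuclideanSpace ℝ (Fin N)) i)
    (sum_eq_zero_of_mem_zeroSumSubspace u.2) (fun t => ?_) hρ
  have h1 : 0 < a ((zeroSumSubspace N).orthogonalProjectionOnto (x t)) := by
    have := ha t
    simp only [map_sub, map_neg] at this
    linarith
  have h2 : a ((zeroSumSubspace N).orthogonalProjectionOnto (x t)) =
      ⟪(u : EuclideanSpace ℝ (Fin N)), x t⟫ := by
    rw [← Submodule.inner_orthogonalProjectionOnto_eq_of_mem_left, hu,
      InnerProductSpace.toDual_symm_apply]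
  rw [h2] at h1
  simpa [portfolioReturn, sampleMatrix, PiLp.inner_apply, mul_comm] using h1

theorem corollary2 {N T : ℕ} (hN : 1 ≤ N) (hT : 1 ≤ T)
    {Ω : Type*} [MeasurableSpace Ω] (μ : Measure Ω) [IsProbabilityMeasure μ]
    (P : Measure (EuclideanSpace ℝ (Fin N))) (hP : IsElliptical P)
    (x : Fin T → Ω → EuclideanSpace ℝ (Fin N))
    (hlaw : ∀ t, HasLaw (x t) P μ) (hindep : iIndepFun x μ) :
    ∃ E : Set Ω, MeasurableSet E ∧ 1 - minimaxProb N T ≤ μ.real E ∧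
      ∀ ω ∈ E, ∀ ρ : (Fin N → ℝ) → Matrix (Fin N) (Fin T) ℝ → ℝ,
        IsCoherentOn ρ (sampleMatrix fun t => x t ω) →
          ¬ IsFeasible ρ (sampleMatrix fun t => x t ω) := by
  obtain ⟨d, rfl⟩ : ∃ d, N = d + 1 := ⟨N - 1, by omega⟩
  obtain ⟨n, rfl⟩ : ∃ n, T = n + 1 := ⟨T - 1, by omega⟩
  rw [one_sub_minimaxProb]
  rcases Nat.eq_zero_or_pos d with rfl | hd
  -- For `N = 1` the bound is `0`. This case must be separate, since a symmetric law on the line may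
  -- have atoms.
  · exact ⟨∅, MeasurableSet.empty, by simp [wendelCount], by simp⟩
  obtain ⟨m, A, ν, hν, hsph, h0, rfl⟩ := hP
  set H := zeroSumSubspace (d + 1) with hH
  have hfin : Module.finrank ℝ H = d := finrank_zeroSumSubspace d
  have : Nontrivial H := Module.nontrivial_of_finrank_pos (R := ℝ) (by omega)
  let Φ : EuclideanSpace ℝ (Fin (d + 1)) → H := fun z => H.orthogonalProjectionOnto (z - m)
  have hΦ : Measurable Φ := by
    have : Continuous Φ := by fun_prop
    exact this.measurable
  let L : EuclideanSpace ℝ (Fin (d + 1)) →L[ℝ] H :=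
    H.orthogonalProjectionOnto ∘L (A : EuclideanSpace ℝ (Fin (d + 1)) →L[ℝ] _)
  have hLsurj : Function.Surjective L := fun h =>
    ⟨A.symm h, by simp [L]⟩
  set Q := ν.map L with hQdef
  have hL : Measurable L := L.continuous.measurable
  have : IsProbabilityMeasure Q := Measure.isProbabilityMeasure_map hL.aemeasurable
  have hnull : ∀ a : H →ₗ[ℝ] ℝ, a ≠ 0 → ∀ c, Q {h | a h = c} = 0 := by
    intro a ha c
    let a' : StrongDual ℝ H := LinearMap.toContinuousLinearMap a
    have hm : MeasurableSet {h | a h = c} :=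
      (isClosed_eq a'.continuous continuous_const).measurableSet
    rw [hQdef, Measure.map_apply hL hm]
    refine hsph.measure_dual_eq_eq_zero h0 (by omega) (b := a' ∘L L) (fun hb => ha ?_) c
    ext h
    obtain ⟨z, rfl⟩ := hLsurj h
    exact congrArg (fun f => f z) hb
  have hsymm : Q.map (fun h => -h) = Q := by
    have hneg := hsph (LinearIsometryEquiv.neg ℝ)
    rw [hQdef, Measure.map_map measurable_neg hL]
    conv_rhs => rw [← hneg, Measure.map_map hL (LinearIsometryEquiv.neg ℝ).continuous.measurable]
    congr 1
    ext1 z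
    simp
  have hlawΦ : ∀ t, μ.map (fun ω => Φ (x t ω)) = Q := by
    intro t
    have hmeas : Measurable fun z => m + A z :=
      (continuous_const.add A.continuous).measurable
    have := AEMeasurable.map_map_of_aemeasurable hΦ.aemeasurable (hlaw t).aemeasurable
    rw [(hlaw t).map_eq, Measure.map_map hΦ hmeas] at this
    refine (this.symm : μ.map (Φ ∘ x t) = _).trans ?_
    rw [hQdef]
    congr 1
    ext1 z
    simp [Φ, L]
  have hYae : ∀ t, AEMeasurable (fun ω => Φ (x t ω)) μ := fun t =>
    hΦ.comp_aemeasurable (hlaw t).aemeasurable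
  have hjoint : μ.map (fun ω t => Φ (x t ω)) = Measure.pi fun _ : Fin (n + 1) => Q := by
    have := (iIndepFun_iff_map_fun_eq_pi_map hYae).1 (hindep.comp (fun _ => Φ) fun _ => hΦ)
    rw [this]
    simp only [hlawΦ]
  set C : Set (Fin (n + 1) → H) :=
    {y | -H.orthogonalProjectionOnto m ∉ convexHull ℝ (Set.range y)} with hC
  have hCm : MeasurableSet C := (isOpen_setOf_notMem_convexHull_range _).measurableSet
  have hY : AEMeasurable (fun ω t => Φ (x t ω)) μ := aemeasurable_pi_lambda _ hYae
  -- The `x t` are only almost everywhere measurable, so the event that the hull misses the point is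
  -- replaced by a measurable subset of equal probability.
  obtain ⟨E, hEsub, hEm, hEeq⟩ :=
    (hY.nullMeasurable hCm).exists_measurable_subset_ae_eq
  refine ⟨E, hEm, ?_, fun ω hω ρ hρ => not_isFeasible_of_notMem_convexHull (hEsub hω) hρ⟩
  have hprob := wendelCount_le_measureReal_notMem_convexHull (n := n + 1) hnull hsymm
    (-H.orthogonalProjectionOnto m)
  rw [hfin, ← hjoint, measureReal_def, Measure.map_apply_of_aemeasurable hY hCm,
    ← measure_congr hEeq] at hprob
  exact hprob
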